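/- A first-order theory $T$ has the independence property if there are a formula $\phi(\bar x,\bar y)$ and a model $M\models T$ containing tuples $(\bar a_i : i\in\omega)$ and $(\bar b_I : I\subseteq\omega)$ such that $M\models\phi(\bar a_i,\bar b_I)$ if and only if $i\in I$. A structure has the independence property if its complete theory does. Let $p$ be a prime number, and let $F$ be either $\mathbb{F}_p$ or its algebraic closure $\mathbb{F}_p^{\mathrm{alg}}$. Then the field $F((t))$ of formal Laurent series, in the language of rings, has the independence property. So does the valued field $F((t))$ with its $t$-adic valuation $v$, regarded as the three-sorted structure $(K,\Gamma,k)$ consisting of the field $K=F((t))$, the ordered value group $\Gamma=\mathbb{Z}$ and the residue field $k$, equipped with the valuation $v:K^{\times}\to\Gamma$ and the quotient map $\mathcal{O}_K=\{x : v(x)\ge 0\}\to k$. -/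

import Mathlib

open FirstOrder

/-- A first-order theory has the independence property if some formula `φ(x̄, ȳ)` and some model `M`
admit tuples `a i` (`i ∈ ω`) and `b I` (`I ⊆ ω`) with `M ⊨ φ(a i, b I)` if and only if `i ∈ I`. -/
def FirstOrder.Language.Theory.HasIndependenceProperty.{u, v}
    {L : FirstOrder.Language.{u, v}} (T : L.Theory) : Prop :=
  ∃ (n m : ℕ) (φ : L.Formula (Fin n ⊕ Fin m)) (M : T.ModelType)
    (a : ℕ → Fin n → (M : Type (max u v))) (b : Set ℕ → Fin m → (M : Type (max u v))),
    ∀ (i : ℕ) (I : Set ℕ), φ.Realize (Sum.elim (a i) (b I)) ↔ i ∈ I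

/-- A field has the independence property if its complete theory in the language of rings does. -/
def FieldHasIP (K : Type*) [Field K] : Prop :=
  letI : FirstOrder.Language.ring.Structure K :=
    (FirstOrder.Ring.compatibleRingOfRing K).toStructure
  (FirstOrder.Language.ring.completeTheory K).HasIndependenceProperty

/-- The residue field `𝒪 / 𝔪` of an additively written valuation `v`, where
`𝒪 = {x | 0 ≤ v x}` and `𝔪` is its maximal ideal `{x | 0 < v x}`. -/
abbrev AddValuation.ResidueField {K Γ : Type*} [Field K] [AddCommGroup Γ] [LinearOrder Γ]
    [IsOrderedAddMonoid Γ] (v : AddValuation K (WithTop Γ)) : Type _ :=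
  IsLocalRing.ResidueField v.toValuation.valuationSubring

/-- The relation symbols of the language of valued fields with the three sorts
`K` (the field), `Γ` (the value group) and `k` (the residue field). As usual, a many-sorted
language is rendered in one-sorted logic by having a predicate for each sort, and the partial
operations between the sorts are given by their graphs. -/
inductive ValuedFieldRel : ℕ → Type
  | isField : ValuedFieldRel 1
  | isValue : ValuedFieldRel 1
  | isResidue : ValuedFieldRel 1
  | fieldZero : ValuedFieldRel 1
  | fieldOne : ValuedFieldRel 1
  | fieldNeg : ValuedFieldRel 2
  | fieldAdd : ValuedFieldRel 3
  | fieldMul : ValuedFieldRel 3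
  | valueZero : ValuedFieldRel 1
  | valueNeg : ValuedFieldRel 2
  | valueAdd : ValuedFieldRel 3
  | valueLE : ValuedFieldRel 2
  | residueZero : ValuedFieldRel 1
  | residueOne : ValuedFieldRel 1
  | residueNeg : ValuedFieldRel 2
  | residueAdd : ValuedFieldRel 3
  | residueMul : ValuedFieldRel 3
  | valuation : ValuedFieldRel 2
  | residueMap : ValuedFieldRel 2

/-- The three-sorted language of valued fields. It has no function symbols. -/
def FirstOrder.Language.valuedField : FirstOrder.Language :=
  ⟨fun _ => Empty, ValuedFieldRel⟩

/-- The universe of the three-sorted structure `(K, Γ, k)` of a valued field `(K, v)`: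
the disjoint union of the field, the value group and the residue field. -/
inductive ValuedFieldUniverse {K Γ : Type*} [Field K] [AddCommGroup Γ] [LinearOrder Γ]
    [IsOrderedAddMonoid Γ] (v : AddValuation K (WithTop Γ))
  | field (x : K)
  | value (γ : Γ)
  | residue (r : v.ResidueField)

open ValuedFieldUniverse in
/-- The structure `(K, Γ, k)` of a valued field `(K, v)`: the field `K`, the ordered group `Γ`,
the field `k`, the valuation `v : Kˣ → Γ` and the quotient map `𝒪 → k`. -/
instance valuedFieldStructure {K Γ : Type*} [Field K] [AddCommGroup Γ] [LinearOrder Γ]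
    [IsOrderedAddMonoid Γ] (v : AddValuation K (WithTop Γ)) :
    FirstOrder.Language.valuedField.Structure (ValuedFieldUniverse v) where
  funMap := fun f => nomatch f
  RelMap := fun {_} R =>
    match R with
    | .isField => fun s => ∃ x, s 0 = field x
    | .isValue => fun s => ∃ γ, s 0 = value γ
    | .isResidue => fun s => ∃ r, s 0 = residue r
    | .fieldZero => fun s => s 0 = field 0
    | .fieldOne => fun s => s 0 = field 1
    | .fieldNeg => fun s => ∃ x, s 0 = field x ∧ s 1 = field (-x)
    | .fieldAdd => fun s => ∃ x y, s 0 = field x ∧ s 1 = field y ∧ s 2 = field (x + y)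
    | .fieldMul => fun s => ∃ x y, s 0 = field x ∧ s 1 = field y ∧ s 2 = field (x * y)
    | .valueZero => fun s => s 0 = value 0
    | .valueNeg => fun s => ∃ γ, s 0 = value γ ∧ s 1 = value (-γ)
    | .valueAdd => fun s => ∃ γ δ, s 0 = value γ ∧ s 1 = value δ ∧ s 2 = value (γ + δ)
    | .valueLE => fun s => ∃ γ δ, s 0 = value γ ∧ s 1 = value δ ∧ γ ≤ δ
    | .residueZero => fun s => s 0 = residue 0
    | .residueOne => fun s => s 0 = residue 1
    | .residueNeg => fun s => ∃ r, s 0 = residue r ∧ s 1 = residue (-r)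
    | .residueAdd => fun s => ∃ r t, s 0 = residue r ∧ s 1 = residue t ∧ s 2 = residue (r + t)
    | .residueMul => fun s => ∃ r t, s 0 = residue r ∧ s 1 = residue t ∧ s 2 = residue (r * t)
    | .valuation => fun s => ∃ (x : K) (γ : Γ), s 0 = field x ∧ s 1 = value γ ∧ v x = γ
    | .residueMap => fun s => ∃ x : v.toValuation.valuationSubring,
        s 0 = field (x : K) ∧ s 1 = residue (IsLocalRing.residue _ x)

/-- A valued field `(K, v)` has the independence property if the complete theory of its
three-sorted structure `(K, Γ, k)` does. -/
def ValuedFieldHasIP {K Γ : Type*} [Field K] [AddCommGroup Γ] [LinearOrder Γ]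
    [IsOrderedAddMonoid Γ] (v : AddValuation K (WithTop Γ)) : Prop :=
  (FirstOrder.Language.valuedField.completeTheory
    (ValuedFieldUniverse v)).HasIndependenceProperty

/-- The `t`-adic valuation on `F((t))`, with value group `ℤ`: it sends a nonzero Laurent series
to the least exponent with nonzero coefficient, and `0` to `∞`. -/
noncomputable abbrev LaurentSeries.tAdicVal (F : Type*) [Field F] :
    AddValuation (LaurentSeries F) (WithTop ℤ) :=
  HahnSeries.addVal ℤ F

/-- The value group of the `t`-adic valuation is all of `ℤ`. -/
theorem LaurentSeries.exists_tAdicVal_eq (F : Type*) [Field F] (n : ℤ) :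
    ∃ x : LaurentSeries F, x ≠ 0 ∧ LaurentSeries.tAdicVal F x = n :=
  ⟨HahnSeries.single n 1, by simp, by
    rw [HahnSeries.addVal_apply, HahnSeries.orderTop_single one_ne_zero]⟩

open FirstOrder.Language

/-! In characteristic `p` the image `A` of `z ↦ z ^ p - z` is an additive subgroup, and `∃ z, z ^ p
= z + x * y` says that `x * y ∈ A`. If `u ∉ A`, it suffices to find, for each `k`, elements with `a
i * b j ≡ u δ_ij` mod `A`: the sum of the `b j` with `j ∉ I` then codes `I`. Since `x ^ p ^ e ≡ x`
mod `A`, Frobenius twists can be inserted freely, which turns an inverse Vandermonde matrix into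
such a system. In `F((t))`, elements of valuation `1` and `-1` serve as `t` and `u`. An ultrapower
joins the finite patterns into an infinite one. -/

/-- Finite independence patterns of every size in `M` yield the independence property of the
complete theory of `M`; the model realizing the infinite pattern is an ultrapower of `M`. -/
theorem FirstOrder.Language.completeTheory_hasIndependenceProperty.{u, v}
    {L : FirstOrder.Language.{u, v}} {M : Type (max u v)} [L.Structure M] [Nonempty M]
    {n m : ℕ} (φ : L.Formula (Fin n ⊕ Fin m))
    (h : ∀ k : ℕ, ∃ (a : ℕ → Fin n → M) (b : Set ℕ → Fin m → M),
      ∀ i < k, ∀ I : Set ℕ, φ.Realize (Sum.elim (a i) (b I)) ↔ i ∈ I) :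
    (L.completeTheory M).HasIndependenceProperty := by
  choose a b hab using h
  let N : Type (max u v) := ((Filter.hyperfilter ℕ : Ultrafilter ℕ) : Filter ℕ).Product fun _ => M
  have hN : N ⊨ L.completeTheory M := by
    refine ⟨fun ψ hψ => (Ultraproduct.sentence_realize ψ).2 ?_⟩
    exact Filter.Eventually.of_forall fun _ => hψ
  let cls : (ℕ → M) → N := fun x => (x : ((Filter.hyperfilter ℕ : Ultrafilter ℕ) :
    Filter ℕ).Product fun _ => M)
  refine ⟨n, m, φ, Theory.ModelType.of _ N, fun i s => cls fun k => a k i s,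
    fun I s => cls fun k => b k I s, fun i I => ?_⟩
  have key := Ultraproduct.realize_formula_cast (u := Filter.hyperfilter ℕ) φ
    (Sum.elim (fun s k => a k i s) fun s k => b k I s)
  have hl : (Sum.elim (fun s => cls fun k => a k i s) fun s => cls fun k => b k I s) =
      fun j => cls ((Sum.elim (fun s k => a k i s) fun s k => b k I s) j) := by
    funext j; cases j <;> rfl
  have hr : ∀ k, (fun j => (Sum.elim (fun s k => a k i s) fun s k => b k I s) j k) =
      Sum.elim (a k i) (b k I) := by
    intro k; funext j; cases j <;> rfl
  simp only [hr] at key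
  refine (iff_of_eq (congrArg φ.Realize hl)).trans (key.trans ?_)
  -- A fixed `i` is handled correctly by the `k`-th pattern for all `k > i`, and a nonprincipal
  -- ultrafilter contains this cofinite set.
  have hev : ∀ᶠ k in ((Filter.hyperfilter ℕ : Ultrafilter ℕ) : Filter ℕ),
      (φ.Realize (Sum.elim (a k i) (b k I)) ↔ i ∈ I) := by
    refine Filter.Eventually.filter_mono Nat.hyperfilter_le_atTop ?_
    filter_upwards [Filter.eventually_gt_atTop i] with k hk using hab k i hk I
  rw [Filter.eventually_congr hev, Filter.eventually_const]

/-! ### Dual systems modulo the Artin–Schreier image -/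

section ArtinSchreier

variable (p : ℕ) [Fact p.Prime] (K : Type*) [Field K] [CharP K p]

/-- The image of the Artin–Schreier map `z ↦ z ^ p - z`. -/
def artinSchreierRange : AddSubgroup K :=
  (((frobenius K p : K →+* K) : K →+ K) - AddMonoidHom.id K).range

variable {p K}

theorem mem_artinSchreierRange {x : K} : x ∈ artinSchreierRange p K ↔ ∃ z, z ^ p - z = x :=
  Iff.rfl

/-- The difference telescopes into Artin–Schreier values of `x ^ p ^ i` for `i < e`. -/
theorem pow_sub_self_mem_artinSchreierRange (x : K) (e : ℕ) :
    x ^ p ^ e - x ∈ artinSchreierRange p K := by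
  induction e with
  | zero => simp
  | succ e ih =>
    have h : (x ^ p ^ e) ^ p - x ^ p ^ e ∈ artinSchreierRange p K := ⟨x ^ p ^ e, rfl⟩
    have := add_mem h ih
    rwa [sub_add_sub_cancel, ← pow_mul, ← pow_succ] at this

/-- Given an element `u` outside the image of the Artin–Schreier map and finitely many nodes
`t ^ p ^ e`, inverting a Vandermonde matrix yields a dual system modulo that image. -/
theorem exists_mul_sub_ite_mem_artinSchreierRange {t : K}
    (ht : Function.Injective fun e : ℕ => t ^ p ^ e) (u : K) (k : ℕ) :
    ∃ a b : Fin k → K, ∀ i j,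
      a i * b j - (if i = j then u else 0) ∈ artinSchreierRange p K := by
  -- The exponent `k - e` makes `w e ^ p ^ e = t ^ p ^ k` independent of `e`, so a single `b j`
  -- serves every summand of `a i`.
  let w : Fin k → K := fun e => t ^ p ^ (k - (e : ℕ))
  have hw : Function.Injective w := by
    intro e e' h
    have h' : k - (e : ℕ) = k - (e' : ℕ) := ht h
    ext
    omega
  let V := Matrix.vandermonde w
  have hV : IsUnit V.det := (Matrix.det_vandermonde_ne_zero_iff.2 hw).isUnit
  refine ⟨fun i => ∑ e, (u * V⁻¹ i e) ^ p ^ (e : ℕ), fun j => t ^ (p ^ k * j), fun i j => ?_⟩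
  have hpow : ∀ e : Fin k, t ^ (p ^ k * (j : ℕ)) = V e j ^ p ^ (e : ℕ) := by
    intro e
    have : p ^ (k - (e : ℕ)) * p ^ (e : ℕ) = p ^ k := by
      rw [← pow_add, Nat.sub_add_cancel e.2.le]
    simp only [V, w, Matrix.vandermonde_apply]
    rw [← pow_mul, ← pow_mul, ← this]
    congr 1
    ring
  have hdual : (if i = j then u else 0) = ∑ e, u * V⁻¹ i e * V e j := by
    have := congrFun (congrFun (Matrix.nonsing_inv_mul V hV) i) j
    rw [Matrix.mul_apply, Matrix.one_apply] at this
    simp_rw [mul_assoc]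
    rw [← Finset.mul_sum, this]
    simp
  rw [hdual, Finset.sum_mul, ← Finset.sum_sub_distrib]
  refine sum_mem fun e _ => ?_
  beta_reduce
  rw [hpow e, ← mul_pow]
  exact pow_sub_self_mem_artinSchreierRange _ _

/-- The formula `∃ z, z ^ p = z + x * y` has independence patterns of every finite size. -/
theorem exists_artinSchreier_pattern {t u : K}
    (ht : Function.Injective fun e : ℕ => t ^ p ^ e) (hu : ¬ ∃ z, z ^ p - z = u) (k : ℕ) :
    ∃ (a : ℕ → K) (b : Set ℕ → K), ∀ i < k, ∀ I : Set ℕ,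
      (∃ z, z ^ p = z + a i * b I) ↔ i ∈ I := by
  classical
  obtain ⟨a, b, hab⟩ := exists_mul_sub_ite_mem_artinSchreierRange ht u k
  refine ⟨fun i => if h : i < k then a ⟨i, h⟩ else 0,
    -- Summing over the complement of `I` makes the product lie in the image exactly when `i ∈ I`.
    fun I => ∑ j : Fin k, if (j : ℕ) ∈ I then 0 else b j, fun i hi I => ?_⟩
  have hsum : a ⟨i, hi⟩ * (∑ j : Fin k, if (j : ℕ) ∈ I then 0 else b j) -
      (if i ∈ I then 0 else u) ∈ artinSchreierRange p K := by
    have : (if i ∈ I then 0 else u) =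
        ∑ j : Fin k, if (j : ℕ) ∈ I then 0 else if (⟨i, hi⟩ : Fin k) = j then u else 0 := by
      rw [Finset.sum_eq_single (⟨i, hi⟩ : Fin k)]
      · simp
      · intro j _ hj
        simp [hj.symm]
      · simp
    rw [this, Finset.mul_sum, ← Finset.sum_sub_distrib]
    refine sum_mem fun j _ => ?_
    split_ifs with h₁ h₂
    · simp
    · simpa [h₂] using hab ⟨i, hi⟩ j
    · simpa [h₂] using hab ⟨i, hi⟩ j
  have hmem : (∃ z, z ^ p = z + a ⟨i, hi⟩ * ∑ j : Fin k, if (j : ℕ) ∈ I then 0 else b j) ↔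
      (if i ∈ I then 0 else u) ∈ artinSchreierRange p K := by
    have := (artinSchreierRange p K).add_mem_cancel_left hsum
      (y := if i ∈ I then 0 else u)
    rw [sub_add_cancel] at this
    rw [← this, mem_artinSchreierRange]
    simp only [sub_eq_iff_eq_add']
  simp only [hi, dif_pos, hmem]
  split_ifs with h
  · simp [h, zero_mem]
  · simp only [h, iff_false]
    exact hu

end ArtinSchreier

/-! ### Valuation criteria for the nodes and for `u` -/

section Valuation

variable {K : Type*} [Field K] (v : AddValuation K (WithTop ℤ))

theorem AddValuation.map_pow_eq_coe {x : K} {a : ℤ} (hx : v x = a) (n : ℕ) :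
    v (x ^ n) = ((n * a : ℤ) : WithTop ℤ) := by
  rw [v.map_pow, hx, ← WithTop.coe_nsmul, nsmul_eq_mul]

theorem AddValuation.injective_pow_prime_pow {p : ℕ} [Fact p.Prime] {t : K} (ht : v t = 1) :
    Function.Injective fun e : ℕ => t ^ p ^ e := by
  intro e e' h
  have h' := congrArg v h
  simp only [v.map_pow_eq_coe (a := 1) ht, WithTop.coe_inj, mul_one, Nat.cast_inj] at h'
  exact Nat.pow_right_injective (Fact.out : p.Prime).two_le h'

/-- If `v z ≥ 0`, then `v (z ^ p - z) ≥ 0`; if `v z < 0`, the term `z ^ p` dominates and the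
valuation is `p * v z ≤ -2`. -/
theorem AddValuation.pow_sub_self_ne {p : ℕ} [Fact p.Prime] {u : K} (hu : v u = (-1 : ℤ)) :
    ¬ ∃ z, z ^ p - z = u := by
  have hp : 2 ≤ p := (Fact.out : p.Prime).two_le
  rintro ⟨z, rfl⟩
  rcases eq_or_ne z 0 with rfl | hz
  · simp [show p ≠ 0 by omega] at hu
    exact WithTop.top_ne_coe (a := (-1 : ℤ)) hu
  obtain ⟨m, hm⟩ := WithTop.ne_top_iff_exists.1 ((AddValuation.ne_top_iff v (x := z)).2 hz)
  have hpow := v.map_pow_eq_coe hm.symm p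
  rcases le_or_gt 0 m with h0 | h0
  · have h1 : ((0 : ℤ) : WithTop ℤ) ≤ v (z ^ p - z) := by
      refine v.map_le_sub ?_ ?_
      · rw [hpow, WithTop.coe_le_coe]; positivity
      · rw [← hm, WithTop.coe_le_coe]; exact h0
    rw [hu, WithTop.coe_le_coe] at h1
    omega
  · have hlt : v (z ^ p) < v z := by
      rw [hpow, ← hm, WithTop.coe_lt_coe]
      nlinarith [show (2 : ℤ) ≤ p by exact_mod_cast hp]
    have h1 : v (z ^ p - z) = v (z ^ p) := v.map_sub_eq_of_lt_left hlt
    rw [hu, hpow, WithTop.coe_inj] at h1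
    nlinarith [show (2 : ℤ) ≤ p by exact_mod_cast hp]

end Valuation

/-! ### The formula in the language of rings -/

section Ring

/-- The `n`-th power of a term in the language of rings. -/
def FirstOrder.Ring.termPow {α : Type*} (s : FirstOrder.Language.ring.Term α) :
    ℕ → FirstOrder.Language.ring.Term α
  | 0 => 1
  | n + 1 => FirstOrder.Ring.termPow s n * s

theorem FirstOrder.Ring.realize_termPow {α R : Type*} [CommRing R]
    [FirstOrder.Ring.CompatibleRing R] (s : FirstOrder.Language.ring.Term α) (n : ℕ)
    (x : α → R) : (FirstOrder.Ring.termPow s n).realize x = s.realize x ^ n := by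
  induction n with
  | zero => simp [FirstOrder.Ring.termPow]
  | succ n ih => simp [FirstOrder.Ring.termPow, ih, pow_succ]

/-- The formula `∃ z, z ^ p = z + x * y` in the language of rings. -/
noncomputable def FirstOrder.Ring.artinSchreierFormula (p : ℕ) :
    FirstOrder.Language.ring.Formula (Fin 1 ⊕ Fin 1) :=
  FirstOrder.Language.Formula.iExs (Fin 1)
    ((FirstOrder.Ring.termPow (Term.var (.inr 0)) p).equal
      (Term.var (.inr 0) + Term.var (.inl (.inl 0)) * Term.var (.inl (.inr 0))))

theorem FirstOrder.Ring.realize_artinSchreierFormula {R : Type*} [CommRing R]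
    [FirstOrder.Ring.CompatibleRing R] (p : ℕ) (x : Fin 1 ⊕ Fin 1 → R) :
    (FirstOrder.Ring.artinSchreierFormula p).Realize x ↔
      ∃ z : R, z ^ p = z + x (.inl 0) * x (.inr 0) := by
  simp only [FirstOrder.Ring.artinSchreierFormula, Formula.realize_iExs, Formula.realize_equal,
    FirstOrder.Ring.realize_termPow, FirstOrder.Ring.realize_add, FirstOrder.Ring.realize_mul,
    Term.realize_var, Sum.elim_inl, Sum.elim_inr]
  exact ⟨fun ⟨z, hz⟩ => ⟨z 0, hz⟩, fun ⟨z, hz⟩ => ⟨fun _ => z, hz⟩⟩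

theorem fieldHasIP_of_not_artinSchreier {p : ℕ} [Fact p.Prime] {K : Type} [Field K] [CharP K p]
    {t u : K} (ht : Function.Injective fun e : ℕ => t ^ p ^ e)
    (hu : ¬ ∃ z, z ^ p - z = u) : FieldHasIP K := by
  let := FirstOrder.Ring.compatibleRingOfRing K
  refine completeTheory_hasIndependenceProperty (FirstOrder.Ring.artinSchreierFormula p)
    fun k => ?_
  obtain ⟨a, b, hab⟩ := exists_artinSchreier_pattern ht hu k
  refine ⟨fun i _ => a i, fun I _ => b I, fun i hi I => ?_⟩
  rw [FirstOrder.Ring.realize_artinSchreierFormula]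
  exact hab i hi I

end Ring

/-! ### The formula in the relational three-sorted language -/

section ValuedField

open ValuedFieldUniverse

/-- The graph of `x ↦ x ^ n` on the field sort. -/
noncomputable def valuedFieldPowFormula : ℕ → FirstOrder.Language.valuedField.Formula (Fin 2)
  | 0 => Relations.formula (L := FirstOrder.Language.valuedField) ValuedFieldRel.fieldOne
      ![Term.var 1]
  | n + 1 => Formula.iExs (Fin 1)
      ((valuedFieldPowFormula n).relabel ![Sum.inl 0, Sum.inr 0] ⊓
        Relations.formula (L := FirstOrder.Language.valuedField) ValuedFieldRel.fieldMul
          ![Term.var (.inr 0), Term.var (.inl 0), Term.var (.inl 1)])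

/-- The formula `∃ z, z ^ p = z + x * y` on the field sort. -/
noncomputable def valuedFieldArtinSchreierFormula (p : ℕ) :
    FirstOrder.Language.valuedField.Formula (Fin 1 ⊕ Fin 1) :=
  -- The three witnesses are `z`, `x * y` and `z + x * y`; the last must equal `z ^ p`.
  Formula.iExs (Fin 3)
    (Relations.formula (L := FirstOrder.Language.valuedField) ValuedFieldRel.fieldMul
        ![Term.var (.inl (.inl 0)), Term.var (.inl (.inr 0)), Term.var (.inr 1)] ⊓
      (Relations.formula (L := FirstOrder.Language.valuedField) ValuedFieldRel.fieldAdd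
        ![Term.var (.inr 0), Term.var (.inr 1), Term.var (.inr 2)] ⊓
      (valuedFieldPowFormula p).relabel ![Sum.inr 0, Sum.inr 2]))

variable {K Γ : Type*} [Field K] [AddCommGroup Γ] [LinearOrder Γ] [IsOrderedAddMonoid Γ]
  {v : AddValuation K (WithTop Γ)}

theorem realize_valuedField_fieldOne {α : Type*} (s : α → ValuedFieldUniverse v) (i : α) :
    (Relations.formula (L := FirstOrder.Language.valuedField) ValuedFieldRel.fieldOne
      ![Term.var i]).Realize s ↔ s i = field 1 := by
  exact Formula.realize_rel.trans Iff.rfl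

theorem realize_valuedField_fieldAdd {α : Type*} (s : α → ValuedFieldUniverse v) (i j l : α) :
    (Relations.formula (L := FirstOrder.Language.valuedField) ValuedFieldRel.fieldAdd
      ![Term.var i, Term.var j, Term.var l]).Realize s ↔
      ∃ x y, s i = field x ∧ s j = field y ∧ s l = field (x + y) := by
  exact Formula.realize_rel.trans Iff.rfl

theorem realize_valuedField_fieldMul {α : Type*} (s : α → ValuedFieldUniverse v) (i j l : α) :
    (Relations.formula (L := FirstOrder.Language.valuedField) ValuedFieldRel.fieldMul
      ![Term.var i, Term.var j, Term.var l]).Realize s ↔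
      ∃ x y, s i = field x ∧ s j = field y ∧ s l = field (x * y) := by
  exact Formula.realize_rel.trans Iff.rfl

theorem realize_valuedFieldPowFormula (n : ℕ) (s : Fin 2 → ValuedFieldUniverse v) {x : K}
    (hx : s 0 = field x) : (valuedFieldPowFormula n).Realize s ↔ s 1 = field (x ^ n) := by
  induction n generalizing s with
  | zero => simp only [valuedFieldPowFormula, realize_valuedField_fieldOne, pow_zero]
  | succ n ih =>
    simp only [valuedFieldPowFormula, Formula.realize_iExs, Formula.realize_inf,
      Formula.realize_relabel, realize_valuedField_fieldMul, Sum.elim_inl, Sum.elim_inr]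
    constructor
    · rintro ⟨w, hw, y, z, hy, hz, h⟩
      rw [ih _ (by simpa using hx)] at hw
      have hw' : w 0 = field (x ^ n) := hw
      rw [hw'] at hy
      rw [hx] at hz
      cases hy
      cases hz
      rw [h, pow_succ]
    · intro h
      refine ⟨fun _ => field (x ^ n), ?_, x ^ n, x, rfl, hx, by rw [h, pow_succ]⟩
      rw [ih _ (by simpa using hx)]
      rfl

theorem realize_valuedFieldArtinSchreierFormula (p : ℕ) (x y : K) :
    (valuedFieldArtinSchreierFormula p).Realize
        (Sum.elim (fun _ => field x) fun _ => field y : _ → ValuedFieldUniverse v) ↔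
      ∃ z : K, z ^ p = z + x * y := by
  simp only [valuedFieldArtinSchreierFormula, Formula.realize_iExs, Formula.realize_inf,
    Formula.realize_relabel, realize_valuedField_fieldMul, realize_valuedField_fieldAdd,
    Sum.elim_inl, Sum.elim_inr]
  constructor
  · rintro ⟨w, ⟨x', y', hx, hy, hxy⟩, ⟨z, q, hz, hq, hzq⟩, hpow⟩
    cases hx
    cases hy
    rw [hxy] at hq
    cases hq
    rw [realize_valuedFieldPowFormula p _ (x := z) hz] at hpow
    have h : w 2 = field (z ^ p) := hpow
    rw [hzq] at h
    injection h with h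
    exact ⟨z, h.symm⟩
  · rintro ⟨z, hz⟩
    refine ⟨![field z, field (x * y), field (z + x * y)], ⟨x, y, rfl, rfl, rfl⟩,
      ⟨z, x * y, rfl, rfl, rfl⟩, ?_⟩
    rw [realize_valuedFieldPowFormula p _ (x := z) rfl, hz]
    rfl

theorem valuedFieldHasIP_of_not_artinSchreier {p : ℕ} [Fact p.Prime] {K Γ : Type} [Field K]
    [AddCommGroup Γ] [LinearOrder Γ] [IsOrderedAddMonoid Γ] (v : AddValuation K (WithTop Γ))
    [CharP K p] {t u : K} (ht : Function.Injective fun e : ℕ => t ^ p ^ e)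
    (hu : ¬ ∃ z, z ^ p - z = u) : ValuedFieldHasIP v := by
  have : Nonempty (ValuedFieldUniverse v) := ⟨field 0⟩
  refine completeTheory_hasIndependenceProperty (valuedFieldArtinSchreierFormula p) fun k => ?_
  obtain ⟨a, b, hab⟩ := exists_artinSchreier_pattern ht hu k
  refine ⟨fun i _ => field (a i), fun I _ => field (b I), fun i hi I => ?_⟩
  rw [realize_valuedFieldArtinSchreierFormula]
  exact hab i hi I

end ValuedField

theorem laurentSeries_hasIP (p : ℕ) [Fact p.Prime] (F : Type) [Field F] [CharP F p] :
    FieldHasIP (LaurentSeries F) ∧ ValuedFieldHasIP (LaurentSeries.tAdicVal F) := by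
  have : CharP (LaurentSeries F) p :=
    charP_of_injective_ringHom (HahnSeries.C_injective (Γ := ℤ) (R := F)) p
  obtain ⟨t, -, ht⟩ := LaurentSeries.exists_tAdicVal_eq F 1
  obtain ⟨u, -, hu⟩ := LaurentSeries.exists_tAdicVal_eq F (-1)
  have ht' := (LaurentSeries.tAdicVal F).injective_pow_prime_pow (p := p) ht
  have hu' := (LaurentSeries.tAdicVal F).pow_sub_self_ne (p := p) hu
  exact ⟨fieldHasIP_of_not_artinSchreier ht' hu', valuedFieldHasIP_of_not_artinSchreier _ ht' hu'⟩

theorem corollary5p5 (p : ℕ) [Fact p.Prime] :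
    (FieldHasIP (LaurentSeries (ZMod p)) ∧
      ValuedFieldHasIP (LaurentSeries.tAdicVal (ZMod p))) ∧
    (FieldHasIP (LaurentSeries (AlgebraicClosure (ZMod p))) ∧
      ValuedFieldHasIP (LaurentSeries.tAdicVal (AlgebraicClosure (ZMod p)))) :=
  haveI : CharP (AlgebraicClosure (ZMod p)) p :=
    charP_of_injective_algebraMap (algebraMap (ZMod p) (AlgebraicClosure (ZMod p))).injective p
  ⟨laurentSeries_hasIP p _, laurentSeries_hasIP p _⟩
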